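/- **Setting.** Let $\nu\ge 1$. Tangential sites are $\nu$ distinct nonzero integers $S=\{\bar\jmath_1,\dots,\bar\jmath_\nu\}$ such that, for some $1\le m\le\nu$, $\bar\jmath_1,\dots,\bar\jmath_m>0$, $\bar\jmath_{m+1},\dots,\bar\jmath_\nu<0$, and $k\neq -j$ for all positive $j\in S$ and all negative $k\in S$. A property holds for a *generic choice of $S$* if there is a polynomial $P:\mathbb C^\nu\to\mathbb C$, not identically zero, such that the property holds for all tangential sites with $P(\bar\jmath_1,\dots,\bar\jmath_\nu)\ne 0$. Put $S^c=\mathbb Z\setminus(S\cup\{0\})$, $$\overline\omega=\big(\sqrt{|\bar\jmath_i|}\big)_{i},\qquad \mathtt v=(\bar\jmath_i)_i,\qquad w=(|\bar\jmath_i|\,\bar\jmath_i)_i,\qquad \mathbb V=\mathtt v\,w^T,$$ and let $\mathbb A$ be the symmetric $\nu\times\nu$ matrix with $$\tfrac12\,\mathbb A I\cdot I=\frac1{4\pi}\sum_{k\in S}|k|^3I_k^2+\frac1\pi\sum_{\substack{k_1,k_2\in S,\ \mathrm{sign}\,k_1=\mathrm{sign}\,k_2\\ |k_2|<|k_1|}}|k_1||k_2|^2I_{k_1}I_{k_2}.$$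 Let $\mathtt b_k:(\mathbb R^\nu)^k\to\mathbb R^\nu$ ($2\le k\le 6$) be $k$-linear maps, and for $\varepsilon>0$ let $$\alpha(I)=\overline\omega+\varepsilon^2\mathbb A I+\sum_{k=2}^6\varepsilon^{2k}\,\mathtt b_k(I,\dots,I)$$ be the frequency-amplitude map. (For the water waves problem, the $\mathtt b_k$ are those produced by the Birkhoff normal form; here they are arbitrary.) Where $\alpha$ is injective on $[1,2]^\nu$, let $\Omega_\varepsilon=\alpha([1,2]^\nu)$ and let $\zeta(\omega)\in[1,2]^\nu$, for $\omega\in\Omega_\varepsilon$, be the solution of $\alpha(\zeta(\omega))=\omega$. For $\omega\in\Omega_\varepsilon$ let $m_1(\omega)=w\cdot\zeta(\omega)$. For $a>0$ put $b=1+a/2$, $\gamma=\varepsilon^{2b}$, $\tau=3\nu+7$, and write $|\ell|=\sum_i|\ell_i|$, $\langle\ell\rangle=\max\{1,|\ell|\}$ for $\ell\in\mathbb Z^\nu$. For $\mathtt C_1,\mathtt C_2>0$ define $$\mathcal G_0^{(0)}=\{\omega\in\Omega_\varepsilon:\ |\omega\cdot\ell|\ge\gamma\langle\ell\rangle^{-\tau}\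 \ \forall \ell\in\mathbb Z^\nu\setminus\{0\}\},$$ $$\mathcal G_0^{(1)}=\{\omega\in\Omega_\varepsilon:\ |(\overline\omega-\varepsilon^2m_1\mathtt v+\varepsilon^2\mathbb A\zeta(\omega))\cdot\ell|\ge\gamma\langle\ell\rangle^{-\tau}\ \ \forall \ell\in\mathbb Z^\nu\setminus\{0\}\},$$ and let $\mathcal G_0^{(2)}(\mathtt C_1,\mathtt C_2)$ be the set of $\omega\in\Omega_\varepsilon$ such that $$\big|(\overline\omega-\varepsilon^2m_1\mathtt v+\varepsilon^2\mathbb A\zeta(\omega))\cdot\ell+\sigma\sqrt{|j|}-\sigma'\sqrt{|k|}\big|\ge\gamma\langle\ell\rangle^{-\tau}$$ for all $\ell\in\mathbb Z^\nu$, $j,k\in S^c$, $\sigma,\sigma'\in\{+1,-1\}$ with $|\ell|\le\mathtt C_1$, $\max\{|j|,|k|\}\le\mathtt C_2$, $\mathtt v\cdot\ell+j-k=0$, except when $\ell=0$, $j=k$ and $\sigma=\sigma'$. Let $\mathcal G_0=\mathcal G_0^{(0)}\cap\mathcal G_0^{(1)}\cap\mathcal G_0^{(2)}(\mathtt C_1,\mathtt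 C_2)$. **Statement.** For a generic choice of $S$ one has $\det(\mathbb A-\mathbb V)\ne0$, and for any constants $\mathtt C_1,\mathtt C_2>0$ there is a constant $C_*>0$, depending only on $S,\mathtt C_1,\mathtt C_2$ (hence only on $S$ if $\mathtt C_1,\mathtt C_2$ depend only on $S$), such that the following holds. For all $k$-linear maps $\mathtt b_k$, $2\le k\le 6$, there is $\varepsilon_0>0$ such that for all $\varepsilon\in(0,\varepsilon_0)$ the map $\alpha$ is injective on $[1,2]^\nu$ and, for all $a>0$, the Lebesgue measure satisfies $$|\Omega_\varepsilon\setminus\mathcal G_0|\le C_*\,\varepsilon^{2(\nu-1)}\,\gamma .$$ -/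

import Mathlib

namespace WaterWave

/-- Tangential sites `j₁, …, j_ν`: distinct nonzero integers, the first `m ≥ 1` of which are positive
and the others negative, such that no negative site is the opposite of a positive one. -/
structure IsTangentialSites {ν : ℕ} (j : Fin ν → ℤ) : Prop where
  injective : Function.Injective j
  signs : ∃ m : ℕ, 1 ≤ m ∧ m ≤ ν ∧
    ∀ i : Fin ν, (i.val < m → 0 < j i) ∧ (m ≤ i.val → j i < 0)
  ne_neg : ∀ i k : Fin ν, 0 < j i → j k < 0 → j k ≠ -j i

/-- `Q` holds for a generic choice of the tangential sites: there is a non-trivial polynomial on `ℂ^ν`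
such that `Q` holds for all tangential sites at which this polynomial does not vanish. -/
def ForGenericSites (ν : ℕ) (Q : (Fin ν → ℤ) → Prop) : Prop :=
  ∃ P : MvPolynomial (Fin ν) ℂ, P ≠ 0 ∧
    ∀ j : Fin ν → ℤ, IsTangentialSites j → MvPolynomial.eval (fun i => (j i : ℂ)) P ≠ 0 → Q j

section Sites

variable {ν : ℕ}

/-- The set `S^c`, that is `ℤ ∖ (S ∪ {0})`. -/
def normalSites (j : Fin ν → ℤ) : Set ℤ := (Set.range j ∪ {0})ᶜ

/-- The linear frequencies `√|j_i|`. -/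
noncomputable def linFreq (j : Fin ν → ℤ) : Fin ν → ℝ := fun i => Real.sqrt |(j i : ℝ)|

/-- The velocity vector `v`, `v_i = j_i`. -/
def velocity (j : Fin ν → ℤ) : Fin ν → ℝ := fun i => (j i : ℝ)

/-- The vector `w`, `w_i = |j_i| j_i`. -/
def weight (j : Fin ν → ℤ) : Fin ν → ℝ := fun i => |(j i : ℝ)| * (j i : ℝ)

/-- The coefficient `|k₁| |k₂|² / π` of `I_{k₁} I_{k₂}` in the fourth order Hamiltonian, present
if `k₁ = j_i` and `k₂ = j_k` have the same sign and `|k₂| < |k₁|`. -/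
noncomputable def crossCoeff (j : Fin ν → ℤ) (i k : Fin ν) : ℝ :=
  if SignType.sign (j i) = SignType.sign (j k) ∧ |j k| < |j i| then
    |(j i : ℝ)| * |(j k : ℝ)| ^ 2 / Real.pi
  else 0

/-- The fourth order Birkhoff normal form Hamiltonian restricted to the tangential sites, as a
function of the actions. -/
noncomputable def hamFour (j : Fin ν → ℤ) (I : Fin ν → ℝ) : ℝ :=
  1 / (4 * Real.pi) * ∑ i, |(j i : ℝ)| ^ 3 * I i ^ 2
    + ∑ i, ∑ k, crossCoeff j i k * I i * I k

/-- The twist matrix `𝔸`: the symmetric matrix with `½ 𝔸 I · I = hamFour j I`, see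
`twistMatrix_isSymm` and `half_twistMatrix_form`. -/
noncomputable def twistMatrix (j : Fin ν → ℤ) : Matrix (Fin ν) (Fin ν) ℝ :=
  Matrix.of fun i k =>
    (if i = k then |(j i : ℝ)| ^ 3 / (2 * Real.pi) else 0) + crossCoeff j i k + crossCoeff j k i

theorem twistMatrix_isSymm (j : Fin ν → ℤ) : (twistMatrix j).IsSymm := by
  ext i k
  simp only [twistMatrix, Matrix.transpose_apply, Matrix.of_apply]
  by_cases h : i = k
  · subst h; ring
  · simp only [h, Ne.symm h, if_false]; ring

theorem half_twistMatrix_form (j : Fin ν → ℤ) (I : Fin ν → ℝ) :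
    1 / 2 * ((twistMatrix j).mulVec I ⬝ᵥ I) = hamFour j I := by
  have hsplit : (twistMatrix j).mulVec I ⬝ᵥ I
      = (∑ i, |(j i : ℝ)| ^ 3 / (2 * Real.pi) * I i * I i)
        + (∑ i, ∑ k, crossCoeff j i k * I i * I k)
        + ∑ i, ∑ k, crossCoeff j k i * I k * I i := by
    simp only [dotProduct, Matrix.mulVec, twistMatrix, Matrix.of_apply, Finset.sum_mul,
      add_mul, Finset.sum_add_distrib, ite_mul, zero_mul, Finset.sum_ite_eq, Finset.mem_univ,
      if_true]
    congr 1
    · congr 1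
      exact Finset.sum_congr rfl fun i _ => Finset.sum_congr rfl fun k _ => by ring
  have hswap : (∑ i, ∑ k, crossCoeff j k i * I k * I i)
      = ∑ i, ∑ k, crossCoeff j i k * I i * I k := Finset.sum_comm
  have hdiag : (∑ i, |(j i : ℝ)| ^ 3 / (2 * Real.pi) * I i * I i)
      = 2 * (1 / (4 * Real.pi) * ∑ i, |(j i : ℝ)| ^ 3 * I i ^ 2) := by
    rw [Finset.mul_sum, Finset.mul_sum]
    refine Finset.sum_congr rfl fun i _ => ?_
    have := Real.pi_ne_zero
    field_simp
    ring
  rw [hsplit, hswap, hdiag, hamFour]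
  ring

/-- The rank one matrix `𝕍 = v wᵀ`. -/
def velocityMatrix (j : Fin ν → ℤ) : Matrix (Fin ν) (Fin ν) ℝ :=
  Matrix.vecMulVec (velocity j) (weight j)

end Sites

/-- A family of `k`-linear maps `b_k : (ℝ^ν)^k → ℝ^ν` (continuity is automatic). -/
abbrev Corrections (ν : ℕ) : Type :=
  (k : ℕ) → ContinuousMultilinearMap ℝ (fun _ : Fin k => Fin ν → ℝ) (Fin ν → ℝ)

section Frequencies

variable {ν : ℕ} (j : Fin ν → ℤ) (β : Corrections ν) (ε : ℝ)

/-- The frequency-amplitude map `α(I) = ω̄ + ε² 𝔸 I + ∑_{k=2}^{6} ε^{2k} b_k(I, …, I)`. -/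
noncomputable def freqAmpl (I : Fin ν → ℝ) : Fin ν → ℝ :=
  linFreq j + ε ^ 2 • (twistMatrix j).mulVec I
    + ∑ k ∈ Finset.Icc 2 6, ε ^ (2 * k) • β k (fun _ => I)

/-- The cube `[1, 2]^ν` of amplitudes. -/
def amplCube (ν : ℕ) : Set (Fin ν → ℝ) := {I | ∀ i, 1 ≤ I i ∧ I i ≤ 2}

/-- The amplitude `ζ(ω) = α⁻¹(ω) ∈ [1, 2]^ν`, for `ω` in `α([1, 2]^ν)`. -/
noncomputable def ampl (ω : Fin ν → ℝ) : Fin ν → ℝ :=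
  Function.invFunOn (freqAmpl j β ε) (amplCube ν) ω

/-- The frequency set `Ω_ε = {ω : ζ(ω) ∈ [1, 2]^ν} = α([1, 2]^ν)`. -/
def freqSet : Set (Fin ν → ℝ) := freqAmpl j β ε '' amplCube ν

/-- `m₁(ω) = w · ζ(ω)`. -/
noncomputable def mOne (ω : Fin ν → ℝ) : ℝ := weight j ⬝ᵥ ampl j β ε ω

/-- The vector `ω̄ - ε² m₁(ω) v + ε² 𝔸 ζ(ω)`. -/
noncomputable def shiftedFreq (ω : Fin ν → ℝ) : Fin ν → ℝ :=
  linFreq j - (ε ^ 2 * mOne j β ε ω) • velocity j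
    + ε ^ 2 • (twistMatrix j).mulVec (ampl j β ε ω)

/-- The length `|ℓ| = ∑ |ℓ_i|` of an integer vector. -/
def len (l : Fin ν → ℤ) : ℝ := ∑ i, |(l i : ℝ)|

/-- `⟨ℓ⟩ = max {1, |ℓ|}`. -/
noncomputable def jap (l : Fin ν → ℤ) : ℝ := max 1 (len l)

/-- The product `x · ℓ`. -/
def pair (x : Fin ν → ℝ) (l : Fin ν → ℤ) : ℝ := x ⬝ᵥ fun i => (l i : ℝ)

/-- `γ = ε^{2b}` with `b = 1 + a / 2`. -/
noncomputable def gam (ε a : ℝ) : ℝ := ε ^ (2 * (1 + a / 2))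

/-- `τ = 3 ν + 7`. -/
def tau (ν : ℕ) : ℕ := 3 * ν + 7

variable (a : ℝ)

/-- The Diophantine frequencies `𝒢₀⁽⁰⁾`. -/
def nonresZero : Set (Fin ν → ℝ) :=
  {ω | ω ∈ freqSet j β ε ∧
    ∀ l : Fin ν → ℤ, l ≠ 0 → gam ε a / jap l ^ tau ν ≤ |pair ω l|}

/-- The set `𝒢₀⁽¹⁾`. -/
def nonresOne : Set (Fin ν → ℝ) :=
  {ω | ω ∈ freqSet j β ε ∧
    ∀ l : Fin ν → ℤ, l ≠ 0 → gam ε a / jap l ^ tau ν ≤ |pair (shiftedFreq j β ε ω) l|}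

/-- The finitely many second Melnikov conditions `𝒢₀⁽²⁾(C₁, C₂)`. The diagonal terms, where the small
divisor is identically zero, are left out. -/
def nonresTwo (C₁ C₂ : ℝ) : Set (Fin ν → ℝ) :=
  {ω | ω ∈ freqSet j β ε ∧
    ∀ l : Fin ν → ℤ, ∀ p ∈ normalSites j, ∀ q ∈ normalSites j, ∀ σ σ' : ℤˣ,
      len l ≤ C₁ → max |(p : ℝ)| |(q : ℝ)| ≤ C₂ →
      pair (velocity j) l + (p : ℝ) - (q : ℝ) = 0 →
      ¬(l = 0 ∧ p = q ∧ σ = σ') →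
      gam ε a / jap l ^ tau ν ≤
        |pair (shiftedFreq j β ε ω) l + ((σ : ℤ) : ℝ) * Real.sqrt (|(p : ℝ)|)
          - ((σ' : ℤ) : ℝ) * Real.sqrt (|(q : ℝ)|)|}

/-- The set `𝒢₀ = 𝒢₀⁽⁰⁾ ∩ 𝒢₀⁽¹⁾ ∩ 𝒢₀⁽²⁾(C₁, C₂)`. -/
def nonres (C₁ C₂ : ℝ) : Set (Fin ν → ℝ) :=
  nonresZero j β ε a ∩ nonresOne j β ε a ∩ nonresTwo j β ε a C₁ C₂

end Frequencies

end WaterWave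

namespace WaterWave

open Matrix MeasureTheory
open scoped ENNReal NNReal

/-! Nondegeneracy is arithmetic. Once the signs and the ordering of the moduli are fixed, `2π𝔸` is
an integer polynomial matrix in the sites whose off-diagonal entries are even, so modulo 2 its
determinant is the product of the cubes of the sites, a non-zero polynomial. Multiplying over the
finitely many patterns gives `twistPoly`. Away from its zeros `2π𝔸` is an invertible integer matrix,
and `det (𝔸 - 𝕍) = 0` would make `π` rational (`det_sub_smul_vecMulVec_ne_zero`).

For the measure, `α` is `ε²𝔸` plus a constant and `O(ε⁴)`, so it is injective with Lipschitz
constant `ε²L`. A resonance in `ω` cuts a slab of width about `δ` from a box of side about `ε²`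
(`volume_freqSet_inter_slab_le`). Since `m₁ v = 𝕍 ζ`, the shifted resonances are slabs in `ζ` with
normal `ε²(𝔸 - 𝕍)ᵀℓ`, of volume `O(δ/ε²)`; applying `α` multiplies this by at most `(ε²L)^ν`
(`volume_shiftedFreq_slab_le`). Both cases give `O(ε^{2(ν-1)} δ)`, and `δ = γ⟨ℓ⟩^{-τ}` is summable
over `ℓ`. -/

/-! ### Generic invertibility of `𝔸` and `𝔸 - 𝕍` -/

/-- The matrix `2π𝔸` as a polynomial in the tangential sites, for a given order pattern `r` and given
signs `s` of the sites. -/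
noncomputable def twistPolyMatrix {ν : ℕ} (r : Fin ν → Fin ν → Bool) (s : Fin ν → ℤˣ) :
    Matrix (Fin ν) (Fin ν) (MvPolynomial (Fin ν) ℤ) :=
  Matrix.of fun i k =>
    (if i = k then MvPolynomial.C ((s i : ℤˣ) : ℤ) * MvPolynomial.X i ^ 3 else 0)
    + (if r i k then 2 * (MvPolynomial.C ((s i : ℤˣ) : ℤ) * MvPolynomial.X i
        * MvPolynomial.X k ^ 2) else 0)
    + (if r k i then 2 * (MvPolynomial.C ((s k : ℤˣ) : ℤ) * MvPolynomial.X k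
        * MvPolynomial.X i ^ 2) else 0)

/-- Modulo 2 the cross terms disappear and the signs become 1, leaving the diagonal matrix of the `X
i ^ 3`. -/
theorem det_twistPolyMatrix_ne_zero {ν : ℕ} (r : Fin ν → Fin ν → Bool) (s : Fin ν → ℤˣ) :
    (twistPolyMatrix r s).det ≠ 0 := by
  intro h
  have h2 := congrArg (MvPolynomial.map (Int.castRingHom (ZMod 2))) h
  rw [RingHom.map_det, map_zero] at h2
  have htwo : (2 : MvPolynomial (Fin ν) (ZMod 2)) = 0 := by
    rw [← map_ofNat (MvPolynomial.C (σ := Fin ν)) 2, show (OfNat.ofNat 2 : ZMod 2) = 0 from rfl,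
      map_zero]
  have hdiag : (MvPolynomial.map (Int.castRingHom (ZMod 2))).mapMatrix (twistPolyMatrix r s)
      = Matrix.diagonal fun i => MvPolynomial.X i ^ 3 := by
    ext1 i k
    have hs : (((s i : ℤˣ) : ℤ) : ZMod 2) = 1 := by
      rcases Int.units_eq_one_or (s i) with h | h <;> rw [h] <;> decide
    simp only [twistPolyMatrix, RingHom.mapMatrix_apply, Matrix.map_apply, Matrix.of_apply,
      Matrix.diagonal_apply, map_add, apply_ite (MvPolynomial.map (Int.castRingHom (ZMod 2))),
      map_mul, map_zero, MvPolynomial.map_C, MvPolynomial.map_X, map_pow, map_ofNat, htwo, zero_mul,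
      ite_self, add_zero, Int.coe_castRingHom, hs, map_one, one_mul]
  rw [hdiag, Matrix.det_diagonal] at h2
  exact Finset.prod_ne_zero_iff.2 (fun i _ => pow_ne_zero 3 (MvPolynomial.X_ne_zero i)) h2

/-- The product of the determinants of `2π𝔸` over all the patterns. -/
noncomputable def twistPoly (ν : ℕ) : MvPolynomial (Fin ν) ℤ :=
  ∏ p : (Fin ν → Fin ν → Bool) × (Fin ν → ℤˣ), (twistPolyMatrix p.1 p.2).det

theorem twistPoly_ne_zero (ν : ℕ) : twistPoly ν ≠ 0 :=
  Finset.prod_ne_zero_iff.2 fun p _ => det_twistPolyMatrix_ne_zero p.1 p.2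

/-- Outside the zeros of `twistPoly`, the matrix `2π𝔸` is an integer matrix with non-zero
determinant. -/
theorem exists_intMatrix_of_eval_twistPoly_ne_zero {ν : ℕ} (j : Fin ν → ℤ)
    (h : MvPolynomial.eval j (twistPoly ν) ≠ 0) :
    ∃ N : Matrix (Fin ν) (Fin ν) ℤ, N.det ≠ 0 ∧
      (2 * Real.pi) • twistMatrix j = N.map (Int.cast : ℤ → ℝ) := by
  -- The actual pattern of the sites; the signs turn each `|j i|` into a polynomial expression.
  let r : Fin ν → Fin ν → Bool := fun i k =>
    decide (SignType.sign (j i) = SignType.sign (j k) ∧ |j k| < |j i|)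
  let s : Fin ν → ℤˣ := fun i => if 0 ≤ j i then 1 else -1
  have hs : ∀ i, (((s i : ℤˣ) : ℤ) : ℝ) * (j i : ℝ) = |(j i : ℝ)| := by
    intro i
    by_cases hi : 0 ≤ j i
    · have : (0 : ℝ) ≤ j i := by exact_mod_cast hi
      simp [s, hi, abs_of_nonneg this]
    · have : (j i : ℝ) ≤ 0 := by exact_mod_cast (not_le.1 hi).le
      simp [s, hi, abs_of_nonpos this]
  refine ⟨(MvPolynomial.eval j).mapMatrix (twistPolyMatrix r s), ?_, ?_⟩
  · rw [← RingHom.map_det]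
    rw [twistPoly, map_prod] at h
    exact Finset.prod_ne_zero_iff.1 h (r, s) (Finset.mem_univ _)
  · have hcross : ∀ i k, 2 * Real.pi * crossCoeff j i k
        = if r i k then 2 * (|(j i : ℝ)| * (j k : ℝ) ^ 2) else 0 := by
      intro i k
      have := Real.pi_ne_zero
      simp only [crossCoeff, r, decide_eq_true_eq, sq_abs]
      split_ifs
      · field_simp
      · simp
    ext i k
    have hd : 2 * Real.pi * (if i = k then |(j i : ℝ)| ^ 3 / (2 * Real.pi) else 0)
        = if i = k then |(j i : ℝ)| * (j i : ℝ) ^ 2 else 0 := by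
      have := Real.pi_ne_zero
      split_ifs
      · rw [← sq_abs (j i : ℝ)]; field_simp
      · simp
    simp only [Matrix.smul_apply, smul_eq_mul, twistMatrix, Matrix.of_apply, mul_add, hd, hcross]
    simp only [← hs, twistPolyMatrix, RingHom.mapMatrix_apply, Matrix.map_apply, Matrix.of_apply,
      map_add, apply_ite (MvPolynomial.eval j), map_mul, map_zero, MvPolynomial.eval_C,
      MvPolynomial.eval_X, map_pow, map_ofNat]
    push_cast
    congr 2
    split_ifs
    · ring
    · rfl

theorem det_twistMatrix_ne_zero {ν : ℕ} (j : Fin ν → ℤ)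
    (h : MvPolynomial.eval j (twistPoly ν) ≠ 0) : (twistMatrix j).det ≠ 0 := by
  obtain ⟨N, hN, hA⟩ := exists_intMatrix_of_eval_twistPoly_ne_zero j h
  intro h0
  have h1 := congrArg Matrix.det hA
  rw [Matrix.det_smul, h0, mul_zero] at h1
  have h2 : ((Int.castRingHom ℝ) N.det) = (N.map (Int.cast : ℤ → ℝ)).det := RingHom.map_det _ _
  rw [← h1] at h2
  exact hN (by simpa using h2)

/-- A rank one perturbation of an invertible integer matrix by an irrational multiple of an integer
matrix is invertible. -/
theorem det_sub_smul_vecMulVec_ne_zero {ν : ℕ} (N : Matrix (Fin ν) (Fin ν) ℤ) (hN : N.det ≠ 0)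
    {t : ℝ} (ht : Irrational t) (v w : Fin ν → ℤ) :
    (N.map (Int.cast : ℤ → ℝ)
      - t • Matrix.vecMulVec (fun i => (v i : ℝ)) (fun i => (w i : ℝ))).det ≠ 0 := by
  have hdet : (N.map (Int.cast : ℤ → ℝ)).det = (N.det : ℝ) :=
    (RingHom.map_det (Int.castRingHom ℝ) N).symm
  have hadj : (N.map (Int.cast : ℤ → ℝ)).adjugate = N.adjugate.map (Int.cast : ℤ → ℝ) :=
    (RingHom.map_adjugate (Int.castRingHom ℝ) N).symm
  have hdet0 : (N.det : ℝ) ≠ 0 := by exact_mod_cast hN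
  have hunit : IsUnit (N.map (Int.cast : ℤ → ℝ)).det := by rw [hdet]; exact hdet0.isUnit
  have hrw : N.map (Int.cast : ℤ → ℝ)
      - t • Matrix.vecMulVec (fun i => (v i : ℝ)) (fun i => (w i : ℝ))
      = N.map (Int.cast : ℤ → ℝ) + replicateCol Unit (fun i => -t * (v i : ℝ))
        * replicateRow Unit (fun i => (w i : ℝ)) := by
    ext i k
    simp [Matrix.mul_apply, Matrix.vecMulVec_apply, sub_eq_add_neg, mul_assoc]
  -- Writing the inverse as adjugate over determinant isolates `t` as the only factor that is not
  -- rational.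
  have hval : (1 + replicateRow Unit (fun i => (w i : ℝ)) * (N.map (Int.cast : ℤ → ℝ))⁻¹
      * replicateCol Unit (fun i => -t * (v i : ℝ))).det
      = 1 - t * ((w ⬝ᵥ N.adjugate *ᵥ v : ℤ) : ℝ) / N.det := by
    rw [Matrix.mul_assoc, Matrix.det_unique, Matrix.inv_def, hdet, hadj, Ring.inverse_eq_inv']
    simp only [Matrix.add_apply, Matrix.one_apply_eq, Matrix.mul_apply, Matrix.replicateRow_apply,
      Matrix.replicateCol_apply, Matrix.smul_apply, Matrix.map_apply, dotProduct, Matrix.mulVec,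
      smul_eq_mul]
    push_cast
    simp only [Finset.mul_sum, Finset.sum_div, sub_eq_add_neg, ← Finset.sum_neg_distrib]
    congr 1
    refine Finset.sum_congr rfl fun i _ => Finset.sum_congr rfl fun k _ => ?_
    field_simp
  rw [hrw, Matrix.det_add_replicateCol_mul_replicateRow hunit, hval, hdet]
  refine mul_ne_zero hdet0 fun h0 => ?_
  -- Vanishing would mean `t * y = det N ≠ 0` with `y` an integer, hence `t` rational.
  set y : ℤ := w ⬝ᵥ N.adjugate *ᵥ v
  have hy : t * (y : ℝ) = N.det := by
    field_simp at h0
    linarith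
  have hy0 : (y : ℝ) ≠ 0 := fun h => hdet0 (by rw [← hy, h, mul_zero])
  refine ht ⟨(N.det : ℚ) / y, ?_⟩
  rw [Rat.cast_div, Rat.cast_intCast, Rat.cast_intCast, ← hy, mul_div_cancel_right₀ _ hy0]

/-- `𝕍` is an integer matrix while `𝔸` carries the factor `1/(2π)`, so irrationality of `2π`
suffices and no second generic polynomial is needed. -/
theorem det_twistMatrix_sub_velocityMatrix_ne_zero {ν : ℕ} (j : Fin ν → ℤ)
    (h : MvPolynomial.eval j (twistPoly ν) ≠ 0) :
    (twistMatrix j - velocityMatrix j).det ≠ 0 := by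
  obtain ⟨N, hN, hA⟩ := exists_intMatrix_of_eval_twistPoly_ne_zero j h
  have hpi : Irrational (2 * Real.pi) := by
    simpa using irrational_pi.natCast_mul (m := 2) two_ne_zero
  have h1 := det_sub_smul_vecMulVec_ne_zero N hN hpi j fun i => |j i| * j i
  rw [← hA] at h1
  have hV : Matrix.vecMulVec (fun i => (j i : ℝ)) (fun i => ((|j i| * j i : ℤ) : ℝ))
      = velocityMatrix j := by
    ext i k
    simp [velocityMatrix, velocity, weight, Matrix.vecMulVec_apply]
  rw [hV, ← smul_sub, Matrix.det_smul] at h1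
  exact right_ne_zero_of_mul h1

theorem forGenericSites_of_eval_twistPoly_ne_zero {ν : ℕ} {Q : (Fin ν → ℤ) → Prop}
    (h : ∀ j : Fin ν → ℤ, MvPolynomial.eval j (twistPoly ν) ≠ 0 → IsTangentialSites j → Q j) :
    ForGenericSites ν Q := by
  refine ⟨MvPolynomial.map (Int.castRingHom ℂ) (twistPoly ν), ?_, fun j hj hP => h j ?_ hj⟩
  · intro h0
    refine twistPoly_ne_zero ν (MvPolynomial.map_injective (Int.castRingHom ℂ) Int.cast_injective ?_)
    rw [h0, map_zero]
  · intro h0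
    apply hP
    rw [MvPolynomial.eval_map]
    have := MvPolynomial.eval₂_comp_left (Int.castRingHom ℂ) (RingHom.id ℤ) j (twistPoly ν)
    rw [RingHom.comp_id] at this
    change MvPolynomial.eval₂ _ (Int.castRingHom ℂ ∘ j) _ = 0
    rw [← this]
    change (Int.castRingHom ℂ) (MvPolynomial.eval j (twistPoly ν)) = 0
    rw [h0, map_zero]

/-! ### Matrix bounds, volumes of slabs and of Lipschitz images -/

theorem exists_norm_mulVec_le {ν : ℕ} (M : Matrix (Fin ν) (Fin ν) ℝ) :
    ∃ K : ℝ, 0 < K ∧ ∀ x : Fin ν → ℝ, ‖M *ᵥ x‖ ≤ K * ‖x‖ := by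
  obtain ⟨K, hK, h⟩ := (LinearMap.toContinuousLinearMap M.mulVecLin).bound
  exact ⟨K, hK, fun x => by simpa using h x⟩

theorem exists_norm_le_norm_mulVec {ν : ℕ} (M : Matrix (Fin ν) (Fin ν) ℝ) (hM : M.det ≠ 0) :
    ∃ K : ℝ, 0 < K ∧ ∀ x : Fin ν → ℝ, ‖x‖ ≤ K * ‖M *ᵥ x‖ := by
  obtain ⟨K, hK, h⟩ := exists_norm_mulVec_le M⁻¹
  refine ⟨K, hK, fun x => ?_⟩
  have := h (M *ᵥ x)
  rwa [Matrix.mulVec_mulVec, Matrix.nonsing_inv_mul M hM.isUnit, Matrix.one_mulVec] at this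

/-- The measure of a slab intersected with a box. -/
theorem volume_box_inter_slab_le {ν : ℕ} (p u : Fin ν → ℝ) (i : Fin ν) (hi : u i ≠ 0) {r : ℝ}
    (hr : 0 ≤ r) (c : ℝ) {δ : ℝ} (hδ : 0 ≤ δ) :
    volume {x : Fin ν → ℝ | (∀ k, |x k - p k| ≤ r) ∧ |c + u ⬝ᵥ x| < δ}
      ≤ ENNReal.ofReal ((2 * r) ^ (ν - 1) * (2 * δ / |u i|)) := by
  -- Replacing the `i`-th coordinate by `u ⬝ᵥ x` has determinant `u i` and maps the set into a
  -- product of intervals.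
  let T : (Fin ν → ℝ) →ₗ[ℝ] (Fin ν → ℝ) := Matrix.toLin' ((1 : Matrix (Fin ν) (Fin ν) ℝ).updateRow i u)
  have hdet : LinearMap.det T = u i := by
    rw [LinearMap.det_toLin', ← Matrix.det_transpose, ← Matrix.updateCol_transpose,
      Matrix.transpose_one, ← Matrix.cramer_apply, Matrix.cramer_one]
    rfl
  have hT : ∀ x k, T x k = if k = i then u ⬝ᵥ x else x k := by
    intro x k
    simp only [T, Matrix.toLin'_apply, Matrix.mulVec]
    split_ifs with h
    · subst h; rw [Matrix.updateRow_self]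
    · rw [Matrix.updateRow_ne h]
      exact congrFun (Matrix.one_mulVec x) k
  let lo : Fin ν → ℝ := fun k => if k = i then -c - δ else p k - r
  let hi' : Fin ν → ℝ := fun k => if k = i then -c + δ else p k + r
  have hsub : {x : Fin ν → ℝ | (∀ k, |x k - p k| ≤ r) ∧ |c + u ⬝ᵥ x| < δ} ⊆ T ⁻¹' Set.Icc lo hi' := by
    rintro x ⟨hx, hs⟩
    rw [abs_lt] at hs
    refine ⟨fun k => ?_, fun k => ?_⟩ <;> rw [hT] <;> simp only [lo, hi'] <;> split_ifs <;>
      linarith [abs_le.1 (hx k)]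
  refine (measure_mono hsub).trans ?_
  rw [Measure.addHaar_preimage_linearMap _ (by rwa [hdet]), hdet, Real.volume_Icc_pi,
    ← ENNReal.ofReal_prod_of_nonneg, ← ENNReal.ofReal_mul (abs_nonneg _)]
  · refine ENNReal.ofReal_le_ofReal (le_of_eq ?_)
    rw [← Finset.mul_prod_erase _ _ (Finset.mem_univ i), Finset.prod_congr rfl
      (g := fun _ => 2 * r) (fun k hk => ?_), Finset.prod_const,
      Finset.card_erase_of_mem (Finset.mem_univ i), Finset.card_univ, Fintype.card_fin, abs_inv]
    · simp only [lo, hi', if_true]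
      ring
    · simp only [lo, hi', if_neg (Finset.ne_of_mem_erase hk)]
      ring
  · intro k _
    simp only [lo, hi']
    split_ifs <;> linarith

/-- For the sup metric, Lebesgue measure is the `ν`-dimensional Hausdorff measure, so the constant
is exactly `K ^ ν`. -/
theorem volume_image_le_of_lipschitzOnWith {ν : ℕ} {f : (Fin ν → ℝ) → Fin ν → ℝ}
    {s : Set (Fin ν → ℝ)} {K : ℝ≥0} (h : LipschitzOnWith K f s) :
    volume (f '' s) ≤ (K : ℝ≥0∞) ^ ν * volume s := by
  have := h.hausdorffMeasure_image_le (d := (ν : ℝ)) (Nat.cast_nonneg _)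
  have hv := hausdorffMeasure_pi_real (ι := Fin ν)
  rw [Fintype.card_fin] at hv
  rwa [hv, ENNReal.rpow_natCast] at this

/-! ### Summation over integer vectors -/

theorem summable_pi_prod {ν : ℕ} {g : ℤ → ℝ} (hg : ∀ n, 0 ≤ g n) (hs : Summable g) :
    Summable fun l : Fin ν → ℤ => ∏ i, g (l i) := by
  classical
  refine summable_of_sum_le (c := ∏ _i : Fin ν, ∑' n, g n)
    (fun l => Finset.prod_nonneg fun i _ => hg _) fun s => ?_
  let t : Fin ν → Finset ℤ := fun i => s.image fun l => l i
  have hst : s ⊆ Fintype.piFinset t := fun l hl =>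
    Fintype.mem_piFinset.2 fun i => Finset.mem_image_of_mem (fun l : Fin ν → ℤ => l i) hl
  calc ∑ l ∈ s, ∏ i, g (l i) ≤ ∑ l ∈ Fintype.piFinset t, ∏ i, g (l i) :=
        Finset.sum_le_sum_of_subset_of_nonneg hst fun l _ _ => Finset.prod_nonneg fun i _ => hg _
    _ = ∏ i, ∑ n ∈ t i, g n := (Finset.prod_univ_sum t fun _ n => g n).symm
    _ ≤ ∏ _i : Fin ν, ∑' n, g n := Finset.prod_le_prod
        (fun i _ => Finset.sum_nonneg fun n _ => hg n) fun i _ => hs.sum_le_tsum _ fun n _ => hg n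

theorem jap_pos {ν : ℕ} (l : Fin ν → ℤ) : 0 < jap l := zero_lt_one.trans_le (le_max_left _ _)

theorem abs_le_len {ν : ℕ} (l : Fin ν → ℤ) (i : Fin ν) : |(l i : ℝ)| ≤ len l :=
  Finset.single_le_sum (f := fun i => |(l i : ℝ)|) (fun _ _ => abs_nonneg _) (Finset.mem_univ i)

/-- Since `τ ≥ 2ν`, the term is dominated by a product of one-dimensional summable factors `max(1,
|l i|)⁻²`. -/
theorem summable_inv_jap_pow {ν : ℕ} : Summable fun l : Fin ν → ℤ => (jap l ^ tau ν)⁻¹ := by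
  have hg : Summable fun n : ℤ => (max 1 |(n : ℝ)| ^ 2)⁻¹ := by
    have h1 : Summable fun n : ℤ => 1 / (n : ℝ) ^ 2 := Real.summable_one_div_int_pow.2 one_lt_two
    have h2 : Summable fun n : ℤ => if n = 0 then (1 : ℝ) else 0 :=
      summable_of_ne_finset_zero (s := {0}) fun n hn => by simpa using hn
    refine (h1.add h2).of_nonneg_of_le (fun n => by positivity) fun n => ?_
    by_cases hn : n = 0
    · simp [hn]
    · have : (1 : ℝ) ≤ |(n : ℝ)| := by exact_mod_cast Int.one_le_abs hn
      simp [hn, max_eq_right this]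
  refine (summable_pi_prod (ν := ν) (fun n => by positivity) hg).of_nonneg_of_le
    (fun l => inv_nonneg.2 (pow_nonneg (jap_pos l).le _)) fun l => ?_
  rw [Finset.prod_inv_distrib]
  refine inv_anti₀ (Finset.prod_pos fun i _ => by positivity) ?_
  calc ∏ i, max 1 |(l i : ℝ)| ^ 2 ≤ ∏ _i : Fin ν, jap l ^ 2 :=
        Finset.prod_le_prod (fun i _ => by positivity) fun i _ =>
          pow_le_pow_left₀ (by positivity) (max_le_max le_rfl (abs_le_len l i)) 2
    _ = jap l ^ (2 * ν) := by simp [pow_mul]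
    _ ≤ jap l ^ tau ν := pow_le_pow_right₀ (le_max_left _ _) (by unfold tau; omega)

theorem measure_iUnion_le_tsum_mul {α ι : Type*} [Countable ι] [MeasurableSpace α] (μ : Measure α)
    (s : ι → Set α) {f : ι → ℝ} (hf : ∀ i, 0 ≤ f i) (hs : Summable f) {D : ℝ} (hD : 0 ≤ D)
    (h : ∀ i, μ (s i) ≤ ENNReal.ofReal (D * f i)) :
    μ (⋃ i, s i) ≤ ENNReal.ofReal (D * ∑' i, f i) := by
  refine (measure_iUnion_le s).trans ((ENNReal.tsum_le_tsum h).trans ?_)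
  rw [← tsum_mul_left, ENNReal.ofReal_tsum_of_nonneg (fun i => mul_nonneg hD (hf i)) (hs.mul_left D)]

/-! ### Injectivity and Lipschitz bound for the frequency-amplitude map -/

theorem isCompact_amplCube (ν : ℕ) : IsCompact (amplCube ν) := by
  have : amplCube ν = Set.Icc (fun _ => 1) (fun _ => 2) := by
    ext I
    simp [amplCube, Set.mem_Icc, Pi.le_def, forall_and]
  rw [this]
  exact isCompact_Icc

theorem convex_amplCube (ν : ℕ) : Convex ℝ (amplCube ν) := by
  have : amplCube ν = Set.Icc (fun _ => 1) (fun _ => 2) := by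
    ext I
    simp [amplCube, Set.mem_Icc, Pi.le_def, forall_and]
  rw [this]
  exact convex_Icc _ _

theorem exists_lipschitz_corrections {ν : ℕ} (β : Corrections ν) :
    ∃ K : ℝ, 0 < K ∧ ∀ ε : ℝ, 0 < ε → ε ≤ 1 → ∀ x ∈ amplCube ν, ∀ y ∈ amplCube ν,
      ‖(∑ k ∈ Finset.Icc 2 6, ε ^ (2 * k) • β k (fun _ => x))
        - ∑ k ∈ Finset.Icc 2 6, ε ^ (2 * k) • β k (fun _ => y)‖ ≤ ε ^ 4 * K * ‖x - y‖ := by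
  have h : ∀ k, ∃ K : ℝ≥0, LipschitzOnWith K (fun x : Fin ν → ℝ => β k fun _ => x) (amplCube ν) := by
    intro k
    refine ContDiffOn.exists_lipschitzOnWith (n := 1) (ContDiff.contDiffOn ?_) one_ne_zero
      (convex_amplCube ν) (isCompact_amplCube ν)
    exact (β k).contDiff.comp (contDiff_pi.2 fun _ => contDiff_id)
  choose K hK using h
  refine ⟨∑ k ∈ Finset.Icc 2 6, (K k : ℝ) + 1, by positivity, fun ε h0 h1 x hx y hy => ?_⟩
  rw [← Finset.sum_sub_distrib]
  calc _ ≤ ∑ k ∈ Finset.Icc 2 6, ε ^ 4 * (K k : ℝ) * ‖x - y‖ := by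
        refine norm_sum_le_of_le _ fun k hk => ?_
        rw [← smul_sub, norm_smul, Real.norm_of_nonneg (by positivity), mul_assoc]
        refine mul_le_mul (pow_le_pow_of_le_one h0.le h1 ?_) ((hK k).norm_sub_le hx hy)
          (norm_nonneg _) (by positivity)
        have := (Finset.mem_Icc.1 hk).1
        omega
    _ = ε ^ 4 * (∑ k ∈ Finset.Icc 2 6, (K k : ℝ)) * ‖x - y‖ := by
        rw [Finset.mul_sum, Finset.sum_mul]
    _ ≤ _ := by gcongr; linarith

/-- The corrections are smaller than the twist by a factor `ε²`. Taking `ε₀` small after `β` is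
known lets `L` depend on the sites alone, which makes the final constant independent of `β`. -/
theorem exists_freqAmpl_estimates {ν : ℕ} (j : Fin ν → ℤ) (hA : (twistMatrix j).det ≠ 0) :
    ∃ L : ℝ, 0 < L ∧ ∀ β : Corrections ν, ∃ ε₀ : ℝ, 0 < ε₀ ∧ ε₀ ≤ 1 ∧ ∀ ε : ℝ, 0 < ε → ε < ε₀ →
      Set.InjOn (freqAmpl j β ε) (amplCube ν) ∧
      ∀ x ∈ amplCube ν, ∀ y ∈ amplCube ν,
        ‖freqAmpl j β ε x - freqAmpl j β ε y‖ ≤ ε ^ 2 * L * ‖x - y‖ := by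
  obtain ⟨N, hN, hAN⟩ := exists_norm_mulVec_le (twistMatrix j)
  obtain ⟨κ, hκ, hAκ⟩ := exists_norm_le_norm_mulVec (twistMatrix j) hA
  refine ⟨N + 1, by positivity, fun β => ?_⟩
  obtain ⟨K, hK, hβ⟩ := exists_lipschitz_corrections β
  -- The bound `K⁻¹` absorbs the corrections into the `+ 1` of `N + 1`; the bound `(κ * K)⁻¹` makes
  -- them too small to cancel the twist.
  refine ⟨min 1 (min K⁻¹ (κ * K)⁻¹), by positivity, min_le_left _ _, fun ε h0 h1 => ?_⟩
  obtain ⟨hε1, hε2, hε3⟩ : ε < 1 ∧ ε < K⁻¹ ∧ ε < (κ * K)⁻¹ := by simpa [lt_min_iff] using h1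
  have hεsq : ε ^ 2 ≤ ε := by nlinarith
  have hKε : ε ^ 2 * K ≤ 1 := by
    rw [lt_inv_comm₀ h0 hK, ← one_div, lt_div_iff₀ h0] at hε2
    nlinarith
  have hκε : κ * (ε ^ 2 * K) < 1 := by
    rw [lt_inv_comm₀ h0 (by positivity), ← one_div, lt_div_iff₀ h0] at hε3
    nlinarith [mul_pos hκ hK]
  have hsplit : ∀ x y, freqAmpl j β ε x - freqAmpl j β ε y = ε ^ 2 • (twistMatrix j) *ᵥ (x - y)
      + ((∑ k ∈ Finset.Icc 2 6, ε ^ (2 * k) • β k (fun _ => x))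
        - ∑ k ∈ Finset.Icc 2 6, ε ^ (2 * k) • β k (fun _ => y)) := by
    intro x y
    simp only [freqAmpl, Matrix.mulVec_sub, smul_sub]
    abel
  have hlin : ∀ x, ‖ε ^ 2 • (twistMatrix j) *ᵥ x‖ = ε ^ 2 * ‖(twistMatrix j) *ᵥ x‖ := fun x => by
    rw [norm_smul, Real.norm_of_nonneg (by positivity)]
  refine ⟨fun x hx y hy hxy => ?_, fun x hx y hy => ?_⟩
  -- Equal images force the twist term to balance the corrections, so `‖x - y‖` is at most a factor
  -- below 1 times itself.
  · have h := hsplit x y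
    rw [hxy, sub_self] at h
    have h2 := hβ ε h0 hε1.le x hx y hy
    rw [← norm_neg, ← eq_neg_of_add_eq_zero_left h.symm, hlin] at h2
    have h3 : ‖(twistMatrix j) *ᵥ (x - y)‖ ≤ ε ^ 2 * K * ‖x - y‖ := by
      refine le_of_mul_le_mul_left (h2.trans_eq ?_) (by positivity : 0 < ε ^ 2)
      ring
    have h4 : ‖x - y‖ ≤ κ * (ε ^ 2 * K) * ‖x - y‖ := by
      rw [mul_assoc]
      exact (hAκ _).trans (mul_le_mul_of_nonneg_left h3 hκ.le)
    have h5 : ‖x - y‖ = 0 := by nlinarith [norm_nonneg (x - y)]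
    exact sub_eq_zero.1 (norm_eq_zero.1 h5)
  · rw [hsplit]
    calc _ ≤ ε ^ 2 * (N * ‖x - y‖) + ε ^ 4 * K * ‖x - y‖ := by
          refine norm_add_le_of_le ?_ (hβ ε h0 hε1.le x hx y hy)
          rw [hlin]
          exact mul_le_mul_of_nonneg_left (hAN _) (by positivity)
      _ = ε ^ 2 * ((N + ε ^ 2 * K) * ‖x - y‖) := by ring
      _ ≤ ε ^ 2 * ((N + 1) * ‖x - y‖) := by gcongr
      _ = _ := by ring

/-! ### Measure of a single resonance -/

theorem exists_one_le_abs_of_ne_zero {ν : ℕ} {l : Fin ν → ℤ} (hl : l ≠ 0) :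
    ∃ i, 1 ≤ |(l i : ℝ)| := by
  obtain ⟨i, hi⟩ := Function.ne_iff.1 hl
  exact ⟨i, by exact_mod_cast Int.one_le_abs hi⟩

theorem exists_one_le_mul_abs_mulVec {ν : ℕ} {M : Matrix (Fin ν) (Fin ν) ℝ} {κ : ℝ} (hκ : 0 < κ)
    (hM : ∀ x, ‖x‖ ≤ κ * ‖M *ᵥ x‖) {l : Fin ν → ℤ} (hl : l ≠ 0) :
    ∃ i, 1 ≤ κ * |(M *ᵥ fun k => (l k : ℝ)) i| := by
  by_contra! h
  obtain ⟨i, hi⟩ := exists_one_le_abs_of_ne_zero hl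
  have h1 : ‖M *ᵥ fun k => (l k : ℝ)‖ < κ⁻¹ := by
    refine (pi_norm_lt_iff (inv_pos.2 hκ)).2 fun i => ?_
    rw [← one_div, lt_div_iff₀ hκ, mul_comm, Real.norm_eq_abs]
    exact h i
  have h2 : κ * ‖M *ᵥ fun k => (l k : ℝ)‖ < 1 := by
    rwa [← one_div, lt_div_iff₀ hκ, mul_comm] at h1
  have h3 := norm_le_pi_norm (fun k => (l k : ℝ)) i
  rw [Real.norm_eq_abs] at h3
  linarith [hM fun k => (l k : ℝ)]

section

variable {ν : ℕ} {j : Fin ν → ℤ} {β : Corrections ν} {ε L : ℝ}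

theorem abs_sub_le_of_mem_freqSet (hε : 0 < ε) (hL : 0 < L)
    (hlip : ∀ x ∈ amplCube ν, ∀ y ∈ amplCube ν,
      ‖freqAmpl j β ε x - freqAmpl j β ε y‖ ≤ ε ^ 2 * L * ‖x - y‖) {ω : Fin ν → ℝ}
    (hω : ω ∈ freqSet j β ε) (k : Fin ν) :
    |ω k - freqAmpl j β ε (fun _ => 1) k| ≤ ε ^ 2 * L := by
  obtain ⟨x, hx, rfl⟩ := hω
  have hone : (fun _ => 1) ∈ amplCube ν := fun _ => ⟨le_rfl, one_le_two⟩
  -- The corner `(1, …, 1)` is within sup distance 1 of the whole cube, so its image centres a box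
  -- of radius `ε²L` containing the frequencies.
  have hdist : ‖x - fun _ => 1‖ ≤ 1 := by
    refine (pi_norm_le_iff_of_nonneg zero_le_one).2 fun i => ?_
    rw [Pi.sub_apply, Real.norm_eq_abs, abs_le]
    constructor <;> linarith [hx i]
  have h := norm_le_pi_norm (freqAmpl j β ε x - freqAmpl j β ε fun _ => 1) k
  rw [Real.norm_eq_abs, Pi.sub_apply] at h
  refine (h.trans (hlip x hx _ hone)).trans ?_
  exact mul_le_of_le_one_right (by positivity) hdist

theorem volume_freqSet_inter_slab_le (hε : 0 < ε) (hL : 0 < L)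
    (hlip : ∀ x ∈ amplCube ν, ∀ y ∈ amplCube ν,
      ‖freqAmpl j β ε x - freqAmpl j β ε y‖ ≤ ε ^ 2 * L * ‖x - y‖) {l : Fin ν → ℤ} (hl : l ≠ 0)
    {δ : ℝ} (hδ : 0 ≤ δ) :
    volume {ω | ω ∈ freqSet j β ε ∧ |pair ω l| < δ}
      ≤ ENNReal.ofReal (2 * (2 * L) ^ (ν - 1) * ε ^ (2 * (ν - 1)) * δ) := by
  obtain ⟨i, hi⟩ := exists_one_le_abs_of_ne_zero hl
  have hi0 : (l i : ℝ) ≠ 0 := fun h => by rw [h, abs_zero] at hi; linarith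
  refine (measure_mono fun ω hω => ?_).trans ((volume_box_inter_slab_le
    (freqAmpl j β ε fun _ => 1) (fun k => (l k : ℝ)) i hi0 (by positivity : 0 ≤ ε ^ 2 * L) 0 hδ).trans
    (ENNReal.ofReal_le_ofReal ?_))
  · refine ⟨abs_sub_le_of_mem_freqSet hε hL hlip hω.1, ?_⟩
    rw [zero_add, dotProduct_comm]
    exact hω.2
  · calc _ ≤ (2 * (ε ^ 2 * L)) ^ (ν - 1) * (2 * δ) := by
          gcongr
          exact div_le_self (by positivity) hi
      _ = _ := by rw [mul_left_comm, mul_pow, pow_mul]; ring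

theorem ampl_mem_and_freqAmpl_ampl {ω : Fin ν → ℝ} (hω : ω ∈ freqSet j β ε) :
    ampl j β ε ω ∈ amplCube ν ∧ freqAmpl j β ε (ampl j β ε ω) = ω :=
  ⟨Function.invFunOn_mem hω, Function.invFunOn_eq hω⟩

/-- The momentum shift is linear in the amplitude, `m₁ v = 𝕍 ζ`, so the small divisor is affine in
`ζ` even though `α` is nonlinear. -/
theorem pair_shiftedFreq (ω : Fin ν → ℝ) (l : Fin ν → ℤ) :
    pair (shiftedFreq j β ε ω) l = pair (linFreq j) l
      + (ε ^ 2 • (twistMatrix j - velocityMatrix j)ᵀ *ᵥ fun k => (l k : ℝ)) ⬝ᵥ ampl j β ε ω := by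
  have hV : velocityMatrix j *ᵥ ampl j β ε ω = mOne j β ε ω • velocity j := by
    ext i
    simp [velocityMatrix, mOne, Matrix.vecMulVec_mulVec, mul_comm]
  have hs : shiftedFreq j β ε ω = linFreq j
      + ε ^ 2 • (twistMatrix j - velocityMatrix j) *ᵥ ampl j β ε ω := by
    rw [Matrix.sub_mulVec, hV, smul_sub, smul_smul, shiftedFreq]
    abel
  rw [hs, pair, pair, add_dotProduct, smul_dotProduct, smul_dotProduct, Matrix.mulVec_transpose,
    ← Matrix.dotProduct_mulVec, dotProduct_comm (_ *ᵥ _)]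

/-- The slab is measured in amplitude space, where the divisor is affine, and then carried back by
`α`. The bound is uniform in `c`, so it serves all normal frequency differences. -/
theorem volume_shiftedFreq_slab_le (hν : 1 ≤ ν) (hε : 0 < ε) (hL : 0 < L)
    (hlip : ∀ x ∈ amplCube ν, ∀ y ∈ amplCube ν,
      ‖freqAmpl j β ε x - freqAmpl j β ε y‖ ≤ ε ^ 2 * L * ‖x - y‖)
    {κ : ℝ} (hκ : 0 < κ) (hM : ∀ x, ‖x‖ ≤ κ * ‖(twistMatrix j - velocityMatrix j)ᵀ *ᵥ x‖)
    {l : Fin ν → ℤ} (hl : l ≠ 0) (c : ℝ) {δ : ℝ} (hδ : 0 ≤ δ) :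
    volume {ω | ω ∈ freqSet j β ε ∧ |c + pair (shiftedFreq j β ε ω) l| < δ}
      ≤ ENNReal.ofReal (2 * L ^ ν * κ * ε ^ (2 * (ν - 1)) * δ) := by
  obtain ⟨i, hi⟩ := exists_one_le_mul_abs_mulVec hκ hM hl
  set u := ε ^ 2 • (twistMatrix j - velocityMatrix j)ᵀ *ᵥ fun k => (l k : ℝ) with hu
  have hui : ε ^ 2 / κ ≤ |u i| := by
    rw [hu, Pi.smul_apply, smul_eq_mul, abs_mul, abs_of_nonneg (sq_nonneg ε), div_eq_mul_inv]
    refine mul_le_mul_of_nonneg_left ?_ (sq_nonneg ε)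
    rwa [inv_le_iff_one_le_mul₀' hκ]
  have hui0 : u i ≠ 0 := abs_pos.1 (lt_of_lt_of_le (by positivity) hui)
  let B : Set (Fin ν → ℝ) :=
    {x | x ∈ amplCube ν ∧ |(c + pair (linFreq j) l) + u ⬝ᵥ x| < δ}
  have hsub : {ω | ω ∈ freqSet j β ε ∧ |c + pair (shiftedFreq j β ε ω) l| < δ}
      ⊆ freqAmpl j β ε '' B := by
    rintro ω ⟨hω, h⟩
    obtain ⟨h1, h2⟩ := ampl_mem_and_freqAmpl_ampl hω
    refine ⟨ampl j β ε ω, ⟨h1, ?_⟩, h2⟩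
    rwa [pair_shiftedFreq, ← hu, ← add_assoc] at h
  have hBvol : volume B ≤ ENNReal.ofReal (2 * δ * κ / ε ^ 2) := by
    refine (measure_mono fun x hx => ?_).trans ((volume_box_inter_slab_le (fun _ => 3 / 2) u i hui0
      (by norm_num : (0 : ℝ) ≤ 1 / 2) (c + pair (linFreq j) l) hδ).trans
      (ENNReal.ofReal_le_ofReal ?_))
    · refine ⟨fun k => ?_, hx.2⟩
      rw [abs_le]
      constructor <;> linarith [hx.1 k]
    · rw [mul_one_div_cancel two_ne_zero, one_pow, one_mul]
      calc 2 * δ / |u i| ≤ 2 * δ / (ε ^ 2 / κ) := by gcongr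
        _ = _ := by field_simp
  have hlipB : LipschitzOnWith (Real.toNNReal (ε ^ 2 * L)) (freqAmpl j β ε) B := by
    refine LipschitzOnWith.of_dist_le_mul fun x hx y hy => ?_
    rw [Real.coe_toNNReal _ (by positivity), dist_eq_norm, dist_eq_norm]
    exact hlip x hx.1 y hy.1
  refine (measure_mono hsub).trans ((volume_image_le_of_lipschitzOnWith hlipB).trans
    ((mul_le_mul_right hBvol _).trans ?_))
  change ENNReal.ofReal (ε ^ 2 * L) ^ ν * _ ≤ _
  rw [← ENNReal.ofReal_pow (by positivity), ← ENNReal.ofReal_mul (by positivity)]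
  refine ENNReal.ofReal_le_ofReal (le_of_eq ?_)
  obtain ⟨n, rfl⟩ : ∃ n, ν = n + 1 := ⟨ν - 1, by omega⟩
  rw [Nat.add_sub_cancel, mul_pow, ← pow_mul, mul_add, pow_add ε]
  field_simp
  ring

end

/-! ### Covering the resonant set and summing -/

/-- The values of `σ √|p| - σ' √|q|` for `|p|, |q| ≤ C`, together with `0`. -/
noncomputable def normalFreqDiffs (C : ℝ) : Finset ℝ :=
  insert 0 ((Finset.Icc (-⌊C⌋) ⌊C⌋ ×ˢ Finset.Icc (-⌊C⌋) ⌊C⌋ ×ˢ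
    (Finset.univ : Finset (ℤˣ × ℤˣ))).image fun t =>
      ((t.2.2.1 : ℤ) : ℝ) * Real.sqrt |(t.1 : ℝ)| - ((t.2.2.2 : ℤ) : ℝ) * Real.sqrt |(t.2.1 : ℝ)|)

theorem mem_normalFreqDiffs {C : ℝ} {p q : ℤ} (h : max |(p : ℝ)| |(q : ℝ)| ≤ C) (σ σ' : ℤˣ) :
    ((σ : ℤ) : ℝ) * Real.sqrt |(p : ℝ)| - ((σ' : ℤ) : ℝ) * Real.sqrt |(q : ℝ)|
      ∈ normalFreqDiffs C := by
  have hmem : ∀ n : ℤ, |(n : ℝ)| ≤ C → n ∈ Finset.Icc (-⌊C⌋) ⌊C⌋ := fun n hn => by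
    rw [Finset.mem_Icc, ← abs_le, Int.le_floor]
    exact_mod_cast hn
  refine Finset.mem_insert_of_mem (Finset.mem_image.2 ⟨(p, q, σ, σ'), ?_, rfl⟩)
  simp only [Finset.mem_product, Finset.mem_univ, and_true]
  exact ⟨hmem p (le_of_max_le_left h), hmem q (le_of_max_le_right h)⟩

theorem gam_nonneg {ε a : ℝ} (hε : 0 ≤ ε) : 0 ≤ gam ε a := Real.rpow_nonneg hε _

theorem gam_le_one {ε a : ℝ} (h0 : 0 ≤ ε) (h1 : ε ≤ 1) (ha : 0 < a) : gam ε a ≤ 1 :=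
  Real.rpow_le_one h0 h1 (by positivity)

/-- The resonant frequencies are covered by countably many slabs. -/
theorem freqSet_diff_nonres_subset {ν : ℕ} (j : Fin ν → ℤ) (β : Corrections ν) {ε a : ℝ}
    (h0 : 0 ≤ ε) (h1 : ε ≤ 1) (ha : 0 < a) (C₁ C₂ : ℝ) :
    freqSet j β ε \ nonres j β ε a C₁ C₂ ⊆
      (⋃ l : {l : Fin ν → ℤ // l ≠ 0},
        {ω | ω ∈ freqSet j β ε ∧ |pair ω l| < gam ε a / jap l.1 ^ tau ν}) ∪
      ⋃ c ∈ normalFreqDiffs C₂, ⋃ l : {l : Fin ν → ℤ // l ≠ 0},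
        {ω | ω ∈ freqSet j β ε ∧
          |c + pair (shiftedFreq j β ε ω) l| < gam ε a / jap l.1 ^ tau ν} := by
  rintro ω ⟨hω, hn⟩
  contrapose! hn
  simp only [Set.mem_union, Set.mem_iUnion, Set.mem_ofPred_eq, not_or, not_exists, not_and,
    not_lt] at hn
  obtain ⟨hz, hs⟩ := hn
  refine ⟨⟨⟨hω, fun l hl => hz ⟨l, hl⟩ hω⟩, ⟨hω, fun l hl => ?_⟩⟩, ⟨hω, ?_⟩⟩
  -- The value `c = 0` in `normalFreqDiffs` accounts for `𝒢₀⁽¹⁾`.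
  · simpa using hs 0 (Finset.mem_insert_self _ _) ⟨l, hl⟩ hω
  · intro l p hp q _ σ σ' _ hpq hmom hne
    -- There is no slab for `ℓ = 0`: momentum conservation gives `p = q`, so `σ ≠ σ'` and the
    -- divisor is `±2√|p|` with `p ≠ 0`, which dominates `γ ≤ 1`.
    by_cases hl : l = 0
    · subst hl
      have hpair : ∀ x : Fin ν → ℝ, pair x 0 = 0 := fun x => by simp [pair]
      rw [hpair] at hmom ⊢
      have hpq' : p = q := by
        have : (p : ℝ) = q := by linarith
        exact_mod_cast this
      subst hpq'
      have hp0 : p ≠ 0 := fun h => hp (Or.inr h)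
      have hsqrt : 1 ≤ Real.sqrt |(p : ℝ)| :=
        Real.one_le_sqrt.2 (by exact_mod_cast Int.one_le_abs hp0)
      have hjap : jap (0 : Fin ν → ℤ) = 1 := by simp [jap, len]
      rw [hjap, one_pow, div_one]
      refine (gam_le_one h0 h1 ha).trans ?_
      have hσ : σ ≠ σ' := fun h => hne ⟨rfl, rfl, h⟩
      rcases Int.units_eq_one_or σ with rfl | rfl <;> rcases Int.units_eq_one_or σ' with rfl | rfl
      · exact absurd rfl hσ
      · refine le_trans ?_ (le_abs_self _)
        push_cast
        linarith
      · refine le_trans ?_ (neg_le_abs _)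
        push_cast
        linarith
      · exact absurd rfl hσ
    · have := hs _ (mem_normalFreqDiffs hpq σ σ') ⟨l, hl⟩ hω
      rwa [sub_add_eq_add_sub, add_comm (_ * _)] at this

theorem volume_freqSet_diff_nonres_le {ν : ℕ} (hν : 1 ≤ ν) {j : Fin ν → ℤ} {β : Corrections ν}
    {ε a L κ : ℝ} (h0 : 0 < ε) (h1 : ε ≤ 1) (ha : 0 < a) (hL : 0 < L) (hκ : 0 < κ)
    (hlip : ∀ x ∈ amplCube ν, ∀ y ∈ amplCube ν,
      ‖freqAmpl j β ε x - freqAmpl j β ε y‖ ≤ ε ^ 2 * L * ‖x - y‖)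
    (hM : ∀ x, ‖x‖ ≤ κ * ‖(twistMatrix j - velocityMatrix j)ᵀ *ᵥ x‖) (C₁ C₂ : ℝ) :
    volume (freqSet j β ε \ nonres j β ε a C₁ C₂) ≤ ENNReal.ofReal
      ((2 * (2 * L) ^ (ν - 1) + (normalFreqDiffs C₂).card * (2 * L ^ ν * κ))
        * (∑' l : {l : Fin ν → ℤ // l ≠ 0}, (jap l.1 ^ tau ν)⁻¹) * ε ^ (2 * (ν - 1)) * gam ε a) := by
  have hγ : 0 ≤ gam ε a := gam_nonneg h0.le
  have hinv : ∀ l : {l : Fin ν → ℤ // l ≠ 0}, 0 ≤ (jap l.1 ^ tau ν)⁻¹ := fun l =>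
    inv_nonneg.2 (pow_nonneg (jap_pos l.1).le _)
  have hsum : Summable fun l : {l : Fin ν → ℤ // l ≠ 0} => (jap l.1 ^ tau ν)⁻¹ :=
    summable_inv_jap_pow.comp_injective Subtype.val_injective
  have hδ : ∀ l : {l : Fin ν → ℤ // l ≠ 0}, 0 ≤ gam ε a / jap l.1 ^ tau ν := fun l =>
    mul_nonneg hγ (hinv l)
  refine (measure_mono (freqSet_diff_nonres_subset j β h0.le h1 ha C₁ C₂)).trans
    ((measure_union_le _ _).trans ?_)
  set Z := ∑' l : {l : Fin ν → ℤ // l ≠ 0}, (jap l.1 ^ tau ν)⁻¹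
  have hZ : 0 ≤ Z := tsum_nonneg hinv
  have hfirst := measure_iUnion_le_tsum_mul volume (fun l : {l : Fin ν → ℤ // l ≠ 0} =>
    {ω | ω ∈ freqSet j β ε ∧ |pair ω l| < gam ε a / jap l.1 ^ tau ν}) hinv hsum
    (D := 2 * (2 * L) ^ (ν - 1) * ε ^ (2 * (ν - 1)) * gam ε a) (by positivity) fun l =>
      (volume_freqSet_inter_slab_le h0 hL hlip l.2 (hδ l)).trans_eq
        (congrArg _ (by rw [div_eq_mul_inv, mul_assoc _ (gam ε a)]))
  have hsecond : ∀ c : ℝ, _ := fun c =>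
    measure_iUnion_le_tsum_mul volume (fun l : {l : Fin ν → ℤ // l ≠ 0} =>
    {ω | ω ∈ freqSet j β ε ∧ |c + pair (shiftedFreq j β ε ω) l| < gam ε a / jap l.1 ^ tau ν})
    hinv hsum (D := 2 * L ^ ν * κ * ε ^ (2 * (ν - 1)) * gam ε a) (by positivity) fun l =>
      (volume_shiftedFreq_slab_le hν h0 hL hlip hκ hM l.2 c (hδ l)).trans_eq
        (congrArg _ (by rw [div_eq_mul_inv, mul_assoc _ (gam ε a)]))
  refine (add_le_add hfirst ((measure_biUnion_finset_le _ _).trans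
    (Finset.sum_le_sum fun c _ => hsecond c))).trans ?_
  rw [Finset.sum_const, ← ENNReal.ofReal_nsmul, ← ENNReal.ofReal_add (by positivity) (by positivity)]
  refine ENNReal.ofReal_le_ofReal (le_of_eq ?_)
  rw [nsmul_eq_mul]
  ring

end WaterWave

theorem mainTheorem7 (ν : ℕ) (hν : 1 ≤ ν) :
    WaterWave.ForGenericSites ν fun j =>
      (WaterWave.twistMatrix j - WaterWave.velocityMatrix j).det ≠ 0 ∧
      ∀ C₁ C₂ : ℝ, 0 < C₁ → 0 < C₂ →
        ∃ Cstar : ℝ, 0 < Cstar ∧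
          ∀ β : WaterWave.Corrections ν, ∃ ε₀ : ℝ, 0 < ε₀ ∧
            ∀ ε : ℝ, 0 < ε → ε < ε₀ →
              Set.InjOn (WaterWave.freqAmpl j β ε) (WaterWave.amplCube ν) ∧
              ∀ a : ℝ, 0 < a →
                MeasureTheory.volume
                    (WaterWave.freqSet j β ε \ WaterWave.nonres j β ε a C₁ C₂) ≤
                  ENNReal.ofReal
                    (Cstar * ε ^ (2 * (ν - 1)) * WaterWave.gam ε a) := by
  open WaterWave in
  refine forGenericSites_of_eval_twistPoly_ne_zero fun j hj _ => ?_
  have hdet := det_twistMatrix_sub_velocityMatrix_ne_zero j hj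
  refine ⟨hdet, fun C₁ C₂ _ _ => ?_⟩
  obtain ⟨L, hL, hest⟩ := exists_freqAmpl_estimates j (det_twistMatrix_ne_zero j hj)
  obtain ⟨κ, hκ, hM⟩ := exists_norm_le_norm_mulVec _ ((Matrix.det_transpose _).trans_ne hdet)
  have hZ : 0 ≤ ∑' l : {l : Fin ν → ℤ // l ≠ 0}, (jap l.1 ^ tau ν)⁻¹ :=
    tsum_nonneg fun l => inv_nonneg.2 (pow_nonneg (jap_pos l.1).le _)
  -- All ingredients are fixed before `β`; the `+ 1` ensures positivity.
  refine ⟨(2 * (2 * L) ^ (ν - 1) + (normalFreqDiffs C₂).card * (2 * L ^ ν * κ))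
    * (∑' l : {l : Fin ν → ℤ // l ≠ 0}, (jap l.1 ^ tau ν)⁻¹) + 1, by positivity, fun β => ?_⟩
  obtain ⟨ε₀, hε₀, hε₁, h⟩ := hest β
  refine ⟨ε₀, hε₀, fun ε h0 h1 => ⟨(h ε h0 h1).1, fun a ha => ?_⟩⟩
  refine (volume_freqSet_diff_nonres_le hν h0 (h1.le.trans hε₁) ha hL hκ (h ε h0 h1).2 hM
    C₁ C₂).trans (ENNReal.ofReal_le_ofReal ?_)
  have hγ : 0 ≤ gam ε a := gam_nonneg h0.le
  gcongr
  exact le_add_of_nonneg_right zero_le_one
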